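/- Let $n\ge 3$, let $\mathcal X$ be a finite set with $|\mathcal X|=n$, let $\hat{\mathcal X}$ be an arbitrary (measurable) reconstruction alphabet and let $\ell:\mathcal X\times\hat{\mathcal X}\to[-\infty,\infty]$ be a loss function, measurable in its second argument. For random variables $X\in\mathcal X$ and $Y$ put $$C(\ell,P_{XY})=\inf_{\hat x\in\hat{\mathcal X}}\mathbb E[\ell(X,\hat x)]-\inf_{\hat X(Y)}\mathbb E[\ell(X,\hat X(Y))],$$ where the second infimum is over all measurable functions $\hat X(Y)\in\hat{\mathcal X}$ of $Y$. Assume that, for all $P_{XY}$ with $Y$ finitely valued, no indeterminate form $\infty-\infty$ occurs in this difference, and that $\ell$ satisfies the Data Processing Axiom: for all finitely valued $Y$, $$C(\ell,P_{TY})\le C(\ell,P_{XY})$$ whenever $T\in\mathcal X$ is a statistically sufficient transformation of $X$ for $Y$, that is, whenever both $T-X-Y$ and $X-T-Y$ are Markov chains ($T$ may be a randomized function of $X$). Then there is a constant $c\ge 0$, depending only on $\ell$, such that for all jointly distributed random variables $X\in\mathcal X$, $Y$, $W$, where $Y$ and $W$ take values in arbitrary measurable spaces, $$\inf_{\hat X_1(W)}\mathbb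 E[\ell(X,\hat X_1(W))]-\inf_{\hat X_2(Y,W)}\mathbb E[\ell(X,\hat X_2(Y,W))]=c\,I(X;Y|W),$$ where the infima are over measurable estimators, both are finite, and $I(X;Y|W)=H(X|W)-H(X|Y,W)$ is the conditional mutual information. -/

import Mathlib

open MeasureTheory
open scoped ENNReal

noncomputable section

namespace SideInfo

/-- Expectation of an extended-real random variable, `E[f⁺] - E[f⁻]`. -/
def expect {Ω : Type*} [MeasurableSpace Ω] (μ : Measure Ω) (f : Ω → EReal) : EReal :=
  ((∫⁻ ω, (f ω).toENNReal ∂μ : ℝ≥0∞) : EReal) - ((∫⁻ ω, (-f ω).toENNReal ∂μ : ℝ≥0∞) : EReal)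

/-- Optimal risk without side information: the infimum of `E[ℓ(X, a)]` over deterministic `a`. -/
def risk {n : ℕ} {A Ω : Type*} [MeasurableSpace Ω] (ℓ : Fin n → A → EReal) (μ : Measure Ω)
    (X : Ω → Fin n) : EReal :=
  ⨅ a : A, expect μ (fun ω => ℓ (X ω) a)

/-- Optimal risk with side information `S`: the infimum of `E[ℓ(X, g(S))]` over measurable
estimators `g`. -/
def riskGiven {n : ℕ} {A Ω 𝒮 : Type*} [MeasurableSpace A] [MeasurableSpace Ω] [MeasurableSpace 𝒮]
    (ℓ : Fin n → A → EReal) (μ : Measure Ω) (X : Ω → Fin n) (S : Ω → 𝒮) : EReal :=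
  ⨅ g : {g : 𝒮 → A // Measurable g}, expect μ (fun ω => ℓ (X ω) (g.1 (S ω)))

/-- The benefit `C(ℓ, P_{XY})` of the side information `Y` for inference on `X`. -/
def benefit {n : ℕ} {A Ω 𝒴 : Type*} [MeasurableSpace A] [MeasurableSpace Ω] [MeasurableSpace 𝒴]
    (ℓ : Fin n → A → EReal) (μ : Measure Ω) (X : Ω → Fin n) (Y : Ω → 𝒴) : EReal :=
  risk ℓ μ X - riskGiven ℓ μ X Y

/-- The benefit of additional side information `Y` for inference on `X`, with common side
information `W`. -/
def benefitGiven {n : ℕ} {A Ω 𝒴 𝒲 : Type*} [MeasurableSpace A] [MeasurableSpace Ω]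
    [MeasurableSpace 𝒴] [MeasurableSpace 𝒲] (ℓ : Fin n → A → EReal) (μ : Measure Ω)
    (X : Ω → Fin n) (Y : Ω → 𝒴) (W : Ω → 𝒲) : EReal :=
  riskGiven ℓ μ X W - riskGiven ℓ μ X (fun ω => (Y ω, W ω))

/-- No indeterminate form `∞ - ∞` appears in `C(ℓ, P_{XY})`, for any `X` and any finitely
valued `Y`. -/
def WellDefined {n : ℕ} {A : Type*} [MeasurableSpace A] (ℓ : Fin n → A → EReal) : Prop :=
  ∀ (Ω : Type) [MeasurableSpace Ω] (μ : Measure Ω) [IsProbabilityMeasure μ]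
    (m : ℕ) (X : Ω → Fin n) (Y : Ω → Fin m), Measurable X → Measurable Y →
    ¬ (risk ℓ μ X = ⊤ ∧ riskGiven ℓ μ X Y = ⊤) ∧ ¬ (risk ℓ μ X = ⊥ ∧ riskGiven ℓ μ X Y = ⊥)

/-- `U - V - Z` is a Markov chain (finite alphabets): `P(u,v,z) P(v) = P(u,v) P(v,z)`. -/
def MarkovChain {Ω 𝒰 𝒱 𝒵 : Type*} [MeasurableSpace Ω] (μ : Measure Ω)
    (U : Ω → 𝒰) (V : Ω → 𝒱) (Z : Ω → 𝒵) : Prop :=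
  ∀ u v z, μ {ω | U ω = u ∧ V ω = v ∧ Z ω = z} * μ {ω | V ω = v} =
    μ {ω | U ω = u ∧ V ω = v} * μ {ω | V ω = v ∧ Z ω = z}

/-- `T` is a statistically sufficient transformation of `X` for `Y`: `T - X - Y` and
`X - T - Y` are Markov chains. The first chain says that `T` is obtained from `X`, possibly
with independent randomization. -/
def Sufficient {Ω 𝒯 𝒳 𝒴 : Type*} [MeasurableSpace Ω] (μ : Measure Ω)
    (T : Ω → 𝒯) (X : Ω → 𝒳) (Y : Ω → 𝒴) : Prop :=
  MarkovChain μ T X Y ∧ MarkovChain μ X T Y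

/-- The Data Processing Axiom: `C(ℓ, P_{TY}) ≤ C(ℓ, P_{XY})` whenever `T`, with values in the
alphabet of `X`, is a statistically sufficient transformation of `X` for `Y`. It is demanded only
for finitely valued `Y`, which is less than demanding it for all `Y`. -/
def DataProcessingAxiom {n : ℕ} {A : Type*} [MeasurableSpace A] (ℓ : Fin n → A → EReal) : Prop :=
  ∀ (Ω : Type) [MeasurableSpace Ω] (μ : Measure Ω) [IsProbabilityMeasure μ]
    (m : ℕ) (X T : Ω → Fin n) (Y : Ω → Fin m), Measurable X → Measurable T → Measurable Y →
    Sufficient μ T X Y → benefit ℓ μ T Y ≤ benefit ℓ μ X Y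

/-- The conditional entropy `H(X | S) = E[-∑ₓ P(X = x | S) log P(X = x | S)]`, in nats. -/
def condEntropy {n : ℕ} {Ω 𝒮 : Type*} [MeasurableSpace Ω] [mS : MeasurableSpace 𝒮]
    (μ : Measure Ω) (X : Ω → Fin n) (S : Ω → 𝒮) : ℝ :=
  ∫ ω, ∑ x : Fin n,
    Real.negMulLog ((μ[(X ⁻¹' {x}).indicator (fun _ => (1 : ℝ)) | mS.comap S]) ω) ∂μ

/-- The conditional mutual information `I(X; Y | W) = H(X | W) - H(X | Y, W)`. -/
def condMutualInfo {n : ℕ} {Ω 𝒴 𝒲 : Type*} [MeasurableSpace Ω] [MeasurableSpace 𝒴]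
    [MeasurableSpace 𝒲] (μ : Measure Ω) (X : Ω → Fin n) (Y : Ω → 𝒴) (W : Ω → 𝒲) : ℝ :=
  condEntropy μ X W - condEntropy μ X (fun ω => (Y ω, W ω))

end SideInfo

end

/-!
Write the loss as a finite baseline of each letter plus a nonnegative excess. Only the minimal
expected excess `V` matters, and it is a positively homogeneous superadditive function of the
weights of the letters. The gain from learning which of two hypotheses holds does not change under
a channel with a common Bayes reversal, because each letter is then sufficient for the other. The
channel merging two letters gives the chain rule of entropy for `V`, and relabelings show that the
value of two letters does not depend on which they are. A third letter turns the chain rule into a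
symmetric cocycle equation for the two-letter value, which is homogeneous and concave; its right
derivative satisfies Cauchy's equation on a multiplicative scale, so it is a multiple of a
logarithm and `V` is a multiple `c` of entropy. Disintegrating along arbitrary side information `S`
and choosing near-optimal actions measurably gives the optimal risk as the mean baseline plus
`c * H(X | S)`.
-/

namespace SideInfo

open scoped NNReal

/-! ### Functional equations -/

section Cauchy

variable {f : ℝ → ℝ} (hadd : ∀ ⦃s t⦄, 0 < s → 0 < t → f (s + t) = f s + f t)
include hadd

lemma map_natCast_succ_mul (k : ℕ) {t : ℝ} (ht : 0 < t) :
    f ((k + 1) * t) = (k + 1) * f t := by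
  induction k with
  | zero => simp
  | succ k ih =>
    push_cast
    rw [add_one_mul, hadd (by positivity) ht, ih]
    ring

variable (hmono : MonotoneOn f (Set.Ioi 0))
include hmono

lemma nonneg_of_additive_of_monotoneOn {t : ℝ} (ht : 0 < t) : 0 ≤ f t := by
  have h : f t ≤ f (t + t) := hmono ht (add_pos ht ht) (by linarith)
  rw [hadd ht ht] at h
  linarith

lemma abs_sub_mul_le_of_additive_of_monotoneOn {t : ℝ} (ht : 0 < t) : |f t - t * f 1| ≤ f 1 := by
  have h1 := nonneg_of_additive_of_monotoneOn hadd hmono one_pos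
  have hfloor : (⌊t⌋₊ : ℝ) ≤ t := Nat.floor_le ht.le
  have hlt : t < ⌊t⌋₊ + 1 := Nat.lt_floor_add_one t
  have hupper : f t ≤ (⌊t⌋₊ + 1) * f 1 := by
    rw [← map_natCast_succ_mul hadd _ one_pos, mul_one]
    exact hmono ht (ht.trans hlt) hlt.le
  have hlower : ⌊t⌋₊ * f 1 ≤ f t := by
    rcases h : ⌊t⌋₊ with _ | k
    · simpa using nonneg_of_additive_of_monotoneOn hadd hmono ht
    · rw [h, Nat.cast_succ] at hfloor
      rw [Nat.cast_succ, ← map_natCast_succ_mul hadd _ one_pos, mul_one]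
      exact hmono (Set.mem_Ioi.2 k.cast_add_one_pos) ht hfloor
  rw [abs_le]
  constructor <;> nlinarith

lemma eq_mul_of_additive_of_monotoneOn {t : ℝ} (ht : 0 < t) : f t = t * f 1 := by
  have hbound (k : ℕ) : (k + 1) * |f t - t * f 1| ≤ f 1 := by
    have hk : (0 : ℝ) < k + 1 := k.cast_add_one_pos
    rw [← abs_of_pos hk, ← abs_mul, mul_sub, ← mul_assoc, ← map_natCast_succ_mul hadd k ht]
    exact abs_sub_mul_le_of_additive_of_monotoneOn hadd hmono (by positivity)
  by_contra hne
  have hpos : 0 < |f t - t * f 1| := abs_pos.2 (sub_ne_zero.2 hne)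
  obtain ⟨k, hk⟩ := Archimedean.arch (f 1) hpos
  have := hbound k
  rw [nsmul_eq_mul] at hk
  linarith

end Cauchy

lemma exists_eq_mul_log_of_monotoneOn {m : ℝ → ℝ}
    (hmul : ∀ ⦃u v⦄, 1 < u → 1 < v → m (u * v) = m u + m v) (hmono : MonotoneOn m (Set.Ioi 1)) :
    ∃ c : ℝ, ∀ u, 1 < u → m u = c * Real.log u := by
  refine ⟨m (Real.exp 1), fun u hu => ?_⟩
  have hadd ⦃s t : ℝ⦄ (hs : 0 < s) (ht : 0 < t) :
      m (Real.exp (s + t)) = m (Real.exp s) + m (Real.exp t) := by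
    rw [Real.exp_add, hmul (Real.one_lt_exp_iff.2 hs) (Real.one_lt_exp_iff.2 ht)]
  have hmono' : MonotoneOn (fun t => m (Real.exp t)) (Set.Ioi 0) := fun s hs t ht hst =>
    hmono (Real.one_lt_exp_iff.2 hs) (Real.one_lt_exp_iff.2 ht) (Real.exp_le_exp.2 hst)
  have h := eq_mul_of_additive_of_monotoneOn hadd hmono' (Real.log_pos hu)
  rwa [Real.exp_log (zero_lt_one.trans hu), mul_comm] at h

/-- The entropy of two letters of masses `x` and `y`, extended homogeneously from `x + y = 1`. -/
noncomputable def entropyCocycle (x y : ℝ) : ℝ :=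
  Real.negMulLog x + Real.negMulLog y - Real.negMulLog (x + y)

lemma entropyCocycle_comm (x y : ℝ) : entropyCocycle x y = entropyCocycle y x := by
  rw [entropyCocycle, entropyCocycle, add_comm x y, add_comm (Real.negMulLog x)]

lemma entropyCocycle_mul_mul (c x y : ℝ) :
    entropyCocycle (c * x) (c * y) = c * entropyCocycle x y := by
  simp only [entropyCocycle, ← mul_add, Real.negMulLog_mul]
  ring

lemma entropyCocycle_one_one_pos : 0 < entropyCocycle 1 1 := by
  norm_num [entropyCocycle, Real.negMulLog, Real.log_pos]

lemma hasDerivAt_entropyCocycle {x y : ℝ} (hx : x ≠ 0) (hxy : x + y ≠ 0) :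
    HasDerivAt (fun t => entropyCocycle t y) (Real.log (x + y) - Real.log x) x := by
  have hsum := (Real.hasDerivAt_negMulLog hxy).comp_add_const x y
  exact (((Real.hasDerivAt_negMulLog hx).add_const (Real.negMulLog y)).sub hsum).congr_deriv
    (by ring)

/-- The functional equation satisfied by the two-letter values of an information measure: a
symmetric, positively homogeneous `2`-cocycle on the positive reals, concave in one variable. -/
structure IsConcaveCocycle (F : ℝ → ℝ → ℝ) : Prop where
  symm : ∀ ⦃x y⦄, 0 < x → 0 < y → F x y = F y x
  map_mul : ∀ ⦃c x y⦄, 0 < c → 0 < x → 0 < y → F (c * x) (c * y) = c * F x y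
  concaveOn : ∀ ⦃y⦄, 0 < y → ConcaveOn ℝ (Set.Ioi 0) fun x => F x y
  cocycle : ∀ ⦃x y z⦄, 0 < x → 0 < y → 0 < z → F (x + y) z + F x y = F x (y + z) + F y z

/-- The right derivative of `F` in its first variable. A right derivative always exists for
concave functions, so no regularity of a cocycle has to be proved beforehand. -/
noncomputable def fstRightDeriv (F : ℝ → ℝ → ℝ) (x y : ℝ) : ℝ :=
  derivWithin (fun t => F t y) (Set.Ioi x) x

namespace IsConcaveCocycle

variable {F : ℝ → ℝ → ℝ} {c x y z : ℝ}

lemma hasDerivWithinAt (hF : IsConcaveCocycle F) (hx : 0 < x) (hy : 0 < y) :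
    HasDerivWithinAt (fun t => F t y) (fstRightDeriv F x y) (Set.Ioi x) x := by
  have h := (hF.concaveOn hy).neg.differentiableWithinAt_Ioi_of_mem_interior
    (x := x) (by simpa using hx)
  have hdiff : DifferentiableWithinAt ℝ (fun t => F t y) (Set.Ioi x) x := by
    simpa only [Pi.neg_def, neg_neg] using h.neg
  exact hdiff.hasDerivWithinAt

lemma antitoneOn_fstRightDeriv (hF : IsConcaveCocycle F) (hy : 0 < y) :
    AntitoneOn (fun x => fstRightDeriv F x y) (Set.Ioi 0) := by
  have h := (hF.concaveOn hy).neg.monotoneOn_rightDeriv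
  rw [interior_Ioi] at h
  simpa only [fstRightDeriv, Pi.neg_def, derivWithin.fun_neg, neg_neg] using h.neg

lemma fstRightDeriv_cocycle (hF : IsConcaveCocycle F) (hx : 0 < x) (hy : 0 < y) (hz : 0 < z) :
    fstRightDeriv F (x + y) z + fstRightDeriv F x y = fstRightDeriv F x (y + z) := by
  have hshift : HasDerivWithinAt (fun t => F (t + y) z) (fstRightDeriv F (x + y) z)
      (Set.Ioi x) x := by
    simpa [Function.comp_def] using (hF.hasDerivWithinAt (add_pos hx hy) hz).scomp x
      (((hasDerivAt_id x).add_const y).hasDerivWithinAt (s := Set.Ioi x))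
      (fun t ht => by simpa using ht)
  have hsum : HasDerivWithinAt (fun t => F (t + y) z + F t y) (fstRightDeriv F x (y + z))
      (Set.Ioi x) x :=
    ((hF.hasDerivWithinAt hx (add_pos hy hz)).add_const (F y z)).congr
      (fun t ht => hF.cocycle (hx.trans ht) hy hz) (hF.cocycle hx hy hz)
  exact (uniqueDiffWithinAt_Ioi x).eq_deriv _ (hshift.add (hF.hasDerivWithinAt hx hy)) hsum

lemma fstRightDeriv_mul_mul (hF : IsConcaveCocycle F) (hc : 0 < c) (hx : 0 < x) (hy : 0 < y) :
    fstRightDeriv F (c * x) (c * y) = fstRightDeriv F x y := by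
  have hscale : HasDerivWithinAt (fun t => F (c * t) (c * y))
      (c * fstRightDeriv F (c * x) (c * y)) (Set.Ioi x) x := by
    simpa [Function.comp_def] using (hF.hasDerivWithinAt (mul_pos hc hx) (mul_pos hc hy)).scomp x
      (((hasDerivAt_id x).const_mul c).hasDerivWithinAt (s := Set.Ioi x))
      (fun t ht => by simpa using mul_lt_mul_of_pos_left ht hc)
  have hmul : HasDerivWithinAt (fun t => F (c * t) (c * y)) (c * fstRightDeriv F x y)
      (Set.Ioi x) x :=
    ((hF.hasDerivWithinAt hx hy).const_mul c).congr
      (fun t ht => hF.map_mul hc (hx.trans ht) hy) (hF.map_mul hc hx hy)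
  exact mul_left_cancel₀ hc.ne' ((uniqueDiffWithinAt_Ioi x).eq_deriv _ hscale hmul)

lemma fstRightDeriv_eq_one (hF : IsConcaveCocycle F) (hx : 0 < x) (hy : 0 < y) :
    fstRightDeriv F x y = fstRightDeriv F 1 (y / x) := by
  rw [← hF.fstRightDeriv_mul_mul hx one_pos (div_pos hy hx), mul_one, mul_div_cancel₀ _ hx.ne']

lemma exists_fstRightDeriv_eq_log (hF : IsConcaveCocycle F) :
    ∃ c : ℝ, ∀ x y, 0 < x → 0 < y →
      fstRightDeriv F x y = c * (Real.log (x + y) - Real.log x) := by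
  have hmul ⦃u v : ℝ⦄ (hu : 1 < u) (hv : 1 < v) : fstRightDeriv F 1 (u * v - 1) =
      fstRightDeriv F 1 (u - 1) + fstRightDeriv F 1 (v - 1) := by
    have hu0 : 0 < u := zero_lt_one.trans hu
    have h := hF.fstRightDeriv_cocycle one_pos (sub_pos.2 hu) (mul_pos hu0 (sub_pos.2 hv))
    rw [add_sub_cancel, hF.fstRightDeriv_eq_one hu0 (mul_pos hu0 (sub_pos.2 hv)),
      mul_div_cancel_left₀ _ hu0.ne'] at h
    rw [add_comm, h]
    ring_nf
  have hmono : MonotoneOn (fun u => fstRightDeriv F 1 (u - 1)) (Set.Ioi 1) := by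
    intro u hu v hv huv
    have hu' : 0 < u - 1 := sub_pos.2 hu
    have hv' : 0 < v - 1 := sub_pos.2 hv
    have hscale : fstRightDeriv F 1 (v - 1) = fstRightDeriv F ((u - 1) / (v - 1)) (u - 1) := by
      rw [hF.fstRightDeriv_eq_one (div_pos hu' hv') hu', div_div_cancel₀ hu'.ne']
    simp only [hscale]
    exact hF.antitoneOn_fstRightDeriv hu' (div_pos hu' hv') (Set.mem_Ioi.2 one_pos)
      ((div_le_one hv').2 (by linarith))
  obtain ⟨c, hc⟩ := exists_eq_mul_log_of_monotoneOn hmul hmono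
  refine ⟨c, fun x y hx hy => ?_⟩
  have hratio : (x + y) / x - 1 = y / x := by field_simp; ring
  rw [hF.fstRightDeriv_eq_one hx hy, ← Real.log_div (by positivity) hx.ne', ← hratio,
    hc _ ((one_lt_div hx).2 (by linarith))]

end IsConcaveCocycle

lemma eqOn_of_hasDerivWithinAt_Ioi_zero {g : ℝ → ℝ} (hcont : ContinuousOn g (Set.Ioi 0))
    (hderiv : ∀ x, 0 < x → HasDerivWithinAt g 0 (Set.Ioi x) x) {a b : ℝ} (ha : 0 < a)
    (hb : 0 < b) : g a = g b := by
  wlog hab : a ≤ b generalizing a b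
  · exact (this hb ha (le_of_not_ge hab)).symm
  · exact (constant_of_has_deriv_right_zero (hcont.mono fun t ht => ha.trans_le ht.1)
      (fun t ht => (hderiv t (ha.trans_le ht.1)).Ici_of_Ioi) b ⟨hab, le_rfl⟩).symm

theorem IsConcaveCocycle.exists_eq_mul_entropyCocycle {F : ℝ → ℝ → ℝ} (hF : IsConcaveCocycle F) :
    ∃ c : ℝ, ∀ x y, 0 < x → 0 < y → F x y = c * entropyCocycle x y := by
  obtain ⟨c, hc⟩ := hF.exists_fstRightDeriv_eq_log
  refine ⟨c, ?_⟩
  set G : ℝ → ℝ → ℝ := fun x y => F x y - c * entropyCocycle x y with hG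
  have hsymm {x y : ℝ} (hx : 0 < x) (hy : 0 < y) : G x y = G y x := by
    simp only [hG, hF.symm hx hy, entropyCocycle_comm x y]
  have hderiv {y : ℝ} (hy : 0 < y) (x : ℝ) (hx : 0 < x) :
      HasDerivWithinAt (fun t => G t y) 0 (Set.Ioi x) x := by
    have hE := (hasDerivAt_entropyCocycle hx.ne' (add_pos hx hy).ne').const_mul c
    exact ((hF.hasDerivWithinAt hx hy).sub hE.hasDerivWithinAt).congr_deriv
      (sub_eq_zero.2 (hc x y hx hy))
  have hcont {y : ℝ} (hy : 0 < y) : ContinuousOn (fun t => G t y) (Set.Ioi 0) := by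
    refine ((hF.concaveOn hy).continuousOn isOpen_Ioi).sub (continuousOn_const.mul ?_)
    unfold entropyCocycle
    fun_prop
  have hconst {x y : ℝ} (hx : 0 < x) (hy : 0 < y) : G x y = G 1 1 := by
    rw [eqOn_of_hasDerivWithinAt_Ioi_zero (hcont hy) (hderiv hy) hx one_pos, hsymm one_pos hy,
      eqOn_of_hasDerivWithinAt_Ioi_zero (hcont one_pos) (hderiv one_pos) hy one_pos]
  have hdouble : G (2 * 1) (2 * 1) = 2 * G 1 1 := by
    simp only [hG, hF.map_mul two_pos one_pos one_pos, entropyCocycle_mul_mul]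
    ring
  have hzero : G 1 1 = 0 := by
    rw [hconst (by norm_num) (by norm_num)] at hdouble
    linarith
  exact fun x y hx hy => sub_eq_zero.1 ((hconst hx hy).trans hzero)

/-! ### Functionals with the data processing property -/

section SufficiencyInvariant

variable {ι : Type*}

/-- Bayes' reversal of a channel: the joint weights `p x * K x t` of an input with weights `p` and
its output under `K` are also those of an input with weights `p'` and its output under `R`, with
the two letters exchanged. -/
def IsReversal (K R : Matrix ι ι ℝ≥0) (p p' : ι → ℝ≥0) : Prop :=
  ∀ x t, p x * K x t = p' t * R t x

namespace IsReversal

variable {K R : Matrix ι ι ℝ≥0} {p p' : ι → ℝ≥0}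

lemma smul (h : IsReversal K R p p') (c : ℝ≥0) : IsReversal K R (c • p) (c • p') := fun x t => by
  simp only [Pi.smul_apply, smul_eq_mul, mul_assoc, h x t]

variable [Fintype ι] [DecidableEq ι]

lemma apply_eq_sum (h : IsReversal K R p p') (hR : R ∈ Matrix.rowStochastic ℝ≥0 ι) (t : ι) :
    p' t = ∑ x, p x * K x t := by
  rw [Fintype.sum_congr _ _ fun x => h x t, ← Finset.mul_sum,
    Matrix.sum_row_of_mem_rowStochastic hR, mul_one]

end IsReversal

variable [DecidableEq ι]

/-- The channel that sends the letter `x` to `f x`. -/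
def deterministicChannel (f : ι → ι) : Matrix ι ι ℝ≥0 :=
  Matrix.of fun x => Pi.single (f x) 1

lemma isReversal_deterministicChannel_single {f g : ι → ι} {x : ι} (hx : g (f x) = x) (w : ℝ≥0) :
    IsReversal (deterministicChannel f) (deterministicChannel g) (Pi.single x w)
      (Pi.single (f x) w) := by
  intro u v
  rcases eq_or_ne u x with rfl | hu
  · rcases eq_or_ne v (f u) with rfl | hv
    · simp [deterministicChannel, hx]
    · simp [deterministicChannel, hv]
  · rcases eq_or_ne v (f x) with rfl | hv
    · simp [deterministicChannel, hx, hu]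
    · simp [deterministicChannel, hu, hv]

variable [Fintype ι]

lemma deterministicChannel_mem_rowStochastic (f : ι → ι) :
    deterministicChannel f ∈ Matrix.rowStochastic ℝ≥0 ι := by
  rw [Matrix.mem_rowStochastic_iff_sum]
  simp [deterministicChannel]

/-- A real functional of finite measures `p` on the alphabet `ι` that behaves like the value of
observing a letter with weights `p`. The last property is what the Data Processing Axiom gives:
the gain `V (p + q) - V p - V q` from learning which of two hypotheses holds is the same for a
letter and for its image under a channel with a Bayes reversal common to both hypotheses. -/
structure IsSufficiencyInvariant (V : (ι → ℝ≥0) → ℝ) : Prop where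
  map_smul : ∀ (c : ℝ≥0) p, V (c • p) = c * V p
  add_le : ∀ p q, V p + V q ≤ V (p + q)
  map_single_one : ∀ x, V (Pi.single x 1) = 0
  defect_eq : ∀ ⦃K R : Matrix ι ι ℝ≥0⦄, K ∈ Matrix.rowStochastic ℝ≥0 ι →
    R ∈ Matrix.rowStochastic ℝ≥0 ι → ∀ ⦃p q p' q'⦄, IsReversal K R p p' → IsReversal K R q q' →
    V (p' + q') - V p' - V q' = V (p + q) - V p - V q

/-- The entropy of a measure on a finite alphabet, extended homogeneously from total mass `1`. -/
noncomputable def coneEntropy (p : ι → ℝ≥0) : ℝ :=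
  ∑ x, Real.negMulLog (p x) - Real.negMulLog (∑ x, (p x : ℝ))

lemma coneEntropy_single (i : ι) (a : ℝ≥0) : coneEntropy (Pi.single i a) = 0 := by
  rw [coneEntropy, Fintype.sum_eq_single i, Fintype.sum_eq_single i, sub_self] <;>
    simp +contextual

lemma coneEntropy_single_add_single {i j : ι} (hij : i ≠ j) (a b : ℝ≥0) :
    coneEntropy (Pi.single i a + Pi.single j b) = entropyCocycle a b := by
  rw [coneEntropy, Fintype.sum_eq_add i j hij, Fintype.sum_eq_add i j hij, entropyCocycle] <;>
    simp +contextual [hij, hij.symm]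

lemma coneEntropy_chain_rule {i j : ι} (hij : i ≠ j) {s : ι → ℝ≥0} (hi : s i = 0) (hj : s j = 0)
    (a b : ℝ≥0) :
    coneEntropy (Pi.single i a + Pi.single j b + s) =
      coneEntropy (Pi.single i (a + b) + s) + coneEntropy (Pi.single i a + Pi.single j b) := by
  set p : ι → ℝ≥0 := Pi.single i a + Pi.single j b + s with hp
  set q : ι → ℝ≥0 := Pi.single i (a + b) + s with hq
  have hsum : ∑ x, Real.negMulLog (p x) - ∑ x, Real.negMulLog (q x) =
      Real.negMulLog a + Real.negMulLog b - Real.negMulLog (a + b) := by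
    rw [← Finset.sum_sub_distrib, Fintype.sum_eq_add i j hij]
    · simp only [hp, hq, Pi.add_apply, Pi.single_eq_same, Pi.single_eq_of_ne hij,
        Pi.single_eq_of_ne hij.symm, hi, hj, add_zero, zero_add, NNReal.coe_add, NNReal.coe_zero,
        Real.negMulLog_zero]
      ring
    · rintro x ⟨hxi, hxj⟩
      simp [hp, hq, hxi, hxj]
  have hmass : ∑ x, p x = ∑ x, q x := by
    simp [hp, hq, Finset.sum_add_distrib]
  rw [coneEntropy_single_add_single hij, entropyCocycle, ← hsum, coneEntropy, coneEntropy,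
    ← NNReal.coe_sum, ← NNReal.coe_sum, hmass]
  ring

lemma exists_eq_mul_of_add_eq_one (a b : ℝ≥0) :
    ∃ w α β : ℝ≥0, α + β = 1 ∧ a = w * α ∧ b = w * β := by
  rcases eq_or_ne (a + b) 0 with h | h
  · obtain ⟨rfl, rfl⟩ := add_eq_zero.1 h
    exact ⟨0, 1, 0, by simp⟩
  · exact ⟨a + b, a / (a + b), b / (a + b), by rw [← add_div, div_self h],
      (mul_div_cancel₀ _ h).symm, (mul_div_cancel₀ _ h).symm⟩

lemma exists_isReversal_merge {i j : ι} (hij : i ≠ j) (a b : ℝ≥0) :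
    ∃ K ∈ Matrix.rowStochastic ℝ≥0 ι, ∃ R ∈ Matrix.rowStochastic ℝ≥0 ι,
      IsReversal K R (Pi.single i a + Pi.single j b) (Pi.single i (a + b)) ∧
      ∀ s : ι → ℝ≥0, s i = 0 → s j = 0 → IsReversal K R s s := by
  obtain ⟨w, α, β, hαβ, rfl, rfl⟩ := exists_eq_mul_of_add_eq_one a b
  refine ⟨deterministicChannel fun x => if x = j then i else x,
    deterministicChannel_mem_rowStochastic _,
    Matrix.of fun t => if t = i then Pi.single i α + Pi.single j β else Pi.single t 1, ?_, ?_, ?_⟩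
  · rw [Matrix.mem_rowStochastic_iff_sum]
    refine ⟨fun _ _ => zero_le, fun t => ?_⟩
    rcases eq_or_ne t i with rfl | ht <;> simp [Finset.sum_add_distrib, *]
  · intro x t
    rw [← mul_add, hαβ, mul_one]
    simp only [deterministicChannel, Matrix.of_apply, Pi.add_apply, Pi.single_apply]
    split_ifs <;> simp_all
  · intro s hi hj x t
    simp only [deterministicChannel, Matrix.of_apply, Pi.single_apply]
    split_ifs <;> simp only [Pi.add_apply, Pi.single_apply] <;> grind

namespace IsSufficiencyInvariant

variable {V : (ι → ℝ≥0) → ℝ} {i j i' j' k : ι}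

lemma map_single (hV : IsSufficiencyInvariant V) (i : ι) (a : ℝ≥0) : V (Pi.single i a) = 0 := by
  rw [← mul_one a, ← smul_eq_mul, Pi.single_smul, hV.map_smul, hV.map_single_one, mul_zero]

lemma chain_rule (hV : IsSufficiencyInvariant V) (hij : i ≠ j) {s : ι → ℝ≥0} (hi : s i = 0)
    (hj : s j = 0) (a b : ℝ≥0) :
    V (Pi.single i a + Pi.single j b + s) =
      V (Pi.single i (a + b) + s) + V (Pi.single i a + Pi.single j b) := by
  obtain ⟨K, hK, R, hR, hpair, hrest⟩ := exists_isReversal_merge hij a b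
  have h := hV.defect_eq hK hR hpair (hrest s hi hj)
  rw [hV.map_single] at h
  linarith

lemma pair_congr (hV : IsSufficiencyInvariant V) (hij : i ≠ j) (hij' : i' ≠ j') (a b : ℝ≥0) :
    V (Pi.single i' a + Pi.single j' b) = V (Pi.single i a + Pi.single j b) := by
  let f : ι → ι := fun x => if x = i then i' else j'
  let g : ι → ι := fun t => if t = i' then i else j
  have hfi : f i = i' := if_pos rfl
  have hfj : f j = j' := if_neg hij.symm
  have hgi : g (f i) = i := by rw [hfi]; exact if_pos rfl
  have hgj : g (f j) = j := by rw [hfj]; exact if_neg hij'.symm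
  have h := hV.defect_eq (deterministicChannel_mem_rowStochastic f)
    (deterministicChannel_mem_rowStochastic g) (isReversal_deterministicChannel_single hgi a)
    (isReversal_deterministicChannel_single hgj b)
  simpa only [hfi, hfj, hV.map_single, sub_zero] using h

lemma pair_comm (hV : IsSufficiencyInvariant V) (hij : i ≠ j) (a b : ℝ≥0) :
    V (Pi.single i a + Pi.single j b) = V (Pi.single i b + Pi.single j a) := by
  rw [hV.pair_congr hij.symm hij, add_comm]

lemma pair_cocycle (hV : IsSufficiencyInvariant V) (hij : i ≠ j) (hik : i ≠ k) (hjk : j ≠ k)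
    (a b c : ℝ≥0) :
    V (Pi.single i (a + b) + Pi.single j c) + V (Pi.single i a + Pi.single j b) =
      V (Pi.single i a + Pi.single j (b + c)) + V (Pi.single i b + Pi.single j c) := by
  have hleft := hV.chain_rule hij (s := Pi.single k c) (by simp [hik]) (by simp [hjk]) a b
  have hright := hV.chain_rule hjk (s := Pi.single i a) (by simp [hij.symm]) (by simp [hik.symm])
    b c
  have hassoc : (Pi.single j b + Pi.single k c + Pi.single i a : ι → ℝ≥0) =
      Pi.single i a + Pi.single j b + Pi.single k c := by
    abel
  rw [hassoc, hleft, add_comm (Pi.single j (b + c) : ι → ℝ≥0)] at hright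
  rwa [hV.pair_congr hij hik, hV.pair_congr hij hjk] at hright

lemma isConcaveCocycle (hV : IsSufficiencyInvariant V) (hij : i ≠ j) (hik : i ≠ k) (hjk : j ≠ k) :
    IsConcaveCocycle fun x y => V (Pi.single i x.toNNReal + Pi.single j y.toNNReal) where
  symm x y _ _ := hV.pair_comm hij _ _
  map_mul c x y hc _ _ := by
    rw [Real.toNNReal_mul hc.le, Real.toNNReal_mul hc.le, ← smul_eq_mul, ← smul_eq_mul,
      Pi.single_smul, Pi.single_smul, ← smul_add, hV.map_smul, Real.coe_toNNReal c hc.le]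
  concaveOn y _ := by
    refine ⟨convex_Ioi 0, fun u hu v hv α β hα hβ hαβ => ?_⟩
    lift u to ℝ≥0 using le_of_lt hu
    lift v to ℝ≥0 using le_of_lt hv
    lift α to ℝ≥0 using hα
    lift β to ℝ≥0 using hβ
    have hmix : (Pi.single i (α * u + β * v) + Pi.single j y.toNNReal : ι → ℝ≥0) =
        α • (Pi.single i u + Pi.single j y.toNNReal) +
          β • (Pi.single i v + Pi.single j y.toNNReal) := by
      have hy' : y.toNNReal = α * y.toNNReal + β * y.toNNReal := by
        rw [← add_mul, NNReal.eq (n := α + β) (m := 1) hαβ, one_mul]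
      conv_lhs => rw [hy']
      simp only [smul_add, ← Pi.single_smul, smul_eq_mul, Pi.single_add]
      abel
    simp only [smul_eq_mul, ← NNReal.coe_mul, ← NNReal.coe_add, Real.toNNReal_coe]
    rw [hmix, ← hV.map_smul, ← hV.map_smul]
    exact hV.add_le _ _
  cocycle x y z hx hy hz := by
    simp only [Real.toNNReal_add hx.le hy.le, Real.toNNReal_add hy.le hz.le]
    exact hV.pair_cocycle hij hik hjk _ _ _

lemma exists_pair_eq (hV : IsSufficiencyInvariant V) (hcard : 3 ≤ Fintype.card ι) :
    ∃ c : ℝ, 0 ≤ c ∧ ∀ ⦃i j : ι⦄, i ≠ j → ∀ a b : ℝ≥0,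
      V (Pi.single i a + Pi.single j b) = c * coneEntropy (Pi.single i a + Pi.single j b) := by
  obtain ⟨i, j, k, hij, hik, hjk⟩ := Fintype.two_lt_card_iff.1 hcard
  obtain ⟨c, hc⟩ := (hV.isConcaveCocycle hij hik hjk).exists_eq_mul_entropyCocycle
  refine ⟨c, ?_, fun i' j' hij' a b => ?_⟩
  · have h := hV.add_le (Pi.single i (1 : ℝ).toNNReal) (Pi.single j (1 : ℝ).toNNReal)
    rw [hc 1 1 one_pos one_pos, hV.map_single, hV.map_single, zero_add] at h
    exact nonneg_of_mul_nonneg_left h entropyCocycle_one_one_pos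
  · rcases eq_zero_or_pos a with rfl | ha
    · simp only [Pi.single_zero, zero_add, hV.map_single, coneEntropy_single, mul_zero]
    rcases eq_zero_or_pos b with rfl | hb
    · simp only [Pi.single_zero, add_zero, hV.map_single, coneEntropy_single, mul_zero]
    have h := hc a b (NNReal.coe_pos.2 ha) (NNReal.coe_pos.2 hb)
    simp only [Real.toNNReal_coe] at h
    rw [hV.pair_congr hij hij', h, coneEntropy_single_add_single hij']

theorem exists_eq_coneEntropy (hV : IsSufficiencyInvariant V) (hcard : 3 ≤ Fintype.card ι) :
    ∃ c : ℝ, 0 ≤ c ∧ ∀ p, V p = c * coneEntropy p := by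
  obtain ⟨c, hc, hpair⟩ := hV.exists_pair_eq hcard
  refine ⟨c, hc, fun p => ?_⟩
  have hfinset (s : Finset ι) : ∀ i ∉ s, ∀ a, V (Pi.single i a + ∑ x ∈ s, Pi.single x (p x)) =
      c * coneEntropy (Pi.single i a + ∑ x ∈ s, Pi.single x (p x)) := by
    induction s using Finset.induction_on with
    | empty => simp [hV.map_single, coneEntropy_single]
    | insert j s hj ih =>
      intro i hi a
      rw [Finset.mem_insert, not_or] at hi
      have hvanish {x : ι} (hx : x ∉ s) : (∑ y ∈ s, Pi.single y (p y)) x = 0 := by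
        rw [Finset.sum_apply]
        exact Finset.sum_eq_zero fun y hy => Pi.single_eq_of_ne (by grind) _
      rw [Finset.sum_insert hj, ← add_assoc, hV.chain_rule hi.1 (hvanish hi.2) (hvanish hj),
        coneEntropy_chain_rule hi.1 (hvanish hi.2) (hvanish hj), ih i hi.2, hpair hi.1, mul_add]
  obtain ⟨i⟩ : Nonempty ι := Fintype.card_pos_iff.1 (by omega)
  have h := hfinset (Finset.univ.erase i) i (Finset.notMem_erase _ _) (p i)
  rwa [Finset.add_sum_erase _ (fun x => Pi.single x (p x)) (Finset.mem_univ i),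
    Finset.univ_sum_single] at h

end IsSufficiencyInvariant

end SufficiencyInvariant

/-! ### Expected losses and minimal excess -/

section Expectation

lemma coe_add_iInf {κ : Sort*} (r : ℝ) (f : κ → ℝ≥0∞) :
    (r : EReal) + (⨅ i, f i : ℝ≥0∞) = ⨅ i, (r : EReal) + f i := by
  have hcont : Continuous fun e : ℝ≥0∞ => (r : EReal) + e :=
    continuous_iff_continuousAt.2 fun e =>
      (EReal.continuousAt_add (p := (r, e)) (by simp) (by simp)).comp
        (f := fun e : ℝ≥0∞ => ((r : EReal), (e : EReal)))
        (continuous_const.prodMk continuous_coe_ennreal_ereal).continuousAt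
  have hmono : Monotone fun e : ℝ≥0∞ => (r : EReal) + e := fun _ _ hab =>
    add_le_add le_rfl (EReal.coe_ennreal_le_coe_ennreal_iff.2 hab)
  exact hmono.map_iInf_of_continuousAt hcont.continuousAt (by simp)

lemma toENNReal_coe_add_add_ofReal_neg (m : ℝ) (e : ℝ≥0∞) :
    ((m : EReal) + e).toENNReal + ENNReal.ofReal (-m) =
      (-((m : EReal) + e)).toENNReal + ENNReal.ofReal m + e := by
  induction e with
  | top => simp
  | coe r =>
    have hcoe : (m : EReal) + ((r : ℝ≥0∞) : EReal) = ((m + r : ℝ) : EReal) := rfl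
    rw [hcoe, ← EReal.coe_neg, EReal.real_coe_toENNReal, EReal.real_coe_toENNReal]
    refine (ENNReal.toReal_eq_toReal_iff' (by simp) (by simp)).1 ?_
    simp only [ENNReal.toReal_add, ENNReal.toReal_ofReal', ENNReal.coe_toReal, ne_eq,
      ENNReal.add_eq_top, ENNReal.ofReal_ne_top, ENNReal.coe_ne_top, or_self, not_false_eq_true]
    linarith [max_zero_sub_max_neg_zero_eq_self m, max_zero_sub_max_neg_zero_eq_self (m + r)]

lemma coe_sub_coe_eq_of_add_eq {P N a b E : ℝ≥0∞} (hN : N ≠ ⊤) (ha : a ≠ ⊤) (hb : b ≠ ⊤)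
    (h : P + b = N + a + E) : (P : EReal) - N = ((a.toReal - b.toReal : ℝ) : EReal) + E := by
  lift N to ℝ≥0 using hN
  lift a to ℝ≥0 using ha
  lift b to ℝ≥0 using hb
  induction E with
  | top =>
    obtain rfl : P = ⊤ := by simpa using h
    rw [EReal.coe_ennreal_top, EReal.add_top_of_ne_bot (EReal.coe_ne_bot _)]
    exact EReal.top_sub_coe (N : ℝ)
  | coe r =>
    have hP : P ≠ ⊤ := fun hP => by
      rw [hP, top_add] at h
      exact ENNReal.top_ne_coe (r := N + a + r) (by exact_mod_cast h)
    lift P to ℝ≥0 using hP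
    have hreal : (P : ℝ) - N = a - b + r := by
      have : (P : ℝ) + b = N + a + r := by exact_mod_cast h
      linarith
    exact congrArg Real.toEReal hreal

lemma coe_add_coe_sub_coe_add_coe (r : ℝ) {a b : ℝ≥0∞} (ha : a ≠ ⊤) (hb : b ≠ ⊤) :
    ((r : EReal) + a) - ((r : EReal) + b) = ((a.toReal - b.toReal : ℝ) : EReal) := by
  lift a to ℝ≥0 using ha
  lift b to ℝ≥0 using hb
  exact congrArg Real.toEReal (add_sub_add_left_eq_sub (a : ℝ) b r)

variable {Ω : Type*} [MeasurableSpace Ω]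

lemma expect_coe_add (μ : Measure Ω) {m : Ω → ℝ} {e : Ω → ℝ≥0∞} (hm : Integrable m μ)
    (he : AEMeasurable e μ) :
    expect μ (fun ω => (m ω : EReal) + e ω) =
      ((∫ ω, m ω ∂μ : ℝ) : EReal) + (∫⁻ ω, e ω ∂μ : ℝ≥0∞) := by
  have hm' : AEMeasurable m μ := hm.aestronglyMeasurable.aemeasurable
  have hpos : ∫⁻ ω, ENNReal.ofReal (m ω) ∂μ ≠ ⊤ := hm.lintegral_lt_top.ne
  have hneg : ∫⁻ ω, ENNReal.ofReal (-m ω) ∂μ ≠ ⊤ := hm.neg.lintegral_lt_top.ne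
  have hneg' : ∫⁻ ω, (-((m ω : EReal) + e ω)).toENNReal ∂μ ≠ ⊤ := by
    refine ne_top_of_le_ne_top hneg (lintegral_mono fun ω => ?_)
    rw [← EReal.real_coe_toENNReal, EReal.coe_neg]
    exact EReal.toENNReal_le_toENNReal
      (EReal.neg_le_neg_iff.2 (le_add_of_nonneg_right (EReal.coe_ennreal_nonneg _)))
  rw [integral_eq_lintegral_pos_part_sub_lintegral_neg_part hm]
  refine coe_sub_coe_eq_of_add_eq hneg' hpos hneg ?_
  rw [← lintegral_add_right' _ (by fun_prop), ← lintegral_add_right' _ (by fun_prop),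
    ← lintegral_add_right' _ he]
  exact lintegral_congr fun ω => toENNReal_coe_add_add_ofReal_neg _ _

lemma expect_dirac [MeasurableSingletonClass Ω] (ω : Ω) (f : Ω → EReal) :
    expect (Measure.dirac ω) f = f ω := by
  simp only [expect, lintegral_dirac]
  rcases le_total 0 (f ω) with h | h
  · rw [EReal.coe_toENNReal h, EReal.toENNReal_of_nonpos (EReal.neg_le_zero.2 h),
      EReal.coe_ennreal_zero, sub_zero]
  · rw [EReal.toENNReal_of_nonpos h, EReal.coe_toENNReal (EReal.neg_nonneg.2 h),
      EReal.coe_ennreal_zero, zero_sub, neg_neg]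

end Expectation

section MinExcess

variable {ι A : Type*} [Fintype ι] {e : ι → A → ℝ≥0∞}

/-- The least weighted excess loss of a single action, for an excess loss `e` and weights `p` on
the letters. -/
noncomputable def minExcess (e : ι → A → ℝ≥0∞) (p : ι → ℝ≥0∞) : ℝ≥0∞ :=
  ⨅ a, ∑ x, p x * e x a

lemma minExcess_ne_top (he : ∃ a, ∀ x, e x a ≠ ⊤) {p : ι → ℝ≥0∞} (hp : ∀ x, p x ≠ ⊤) :
    minExcess e p ≠ ⊤ := by
  obtain ⟨a, ha⟩ := he
  exact ne_top_of_le_ne_top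
    (ENNReal.sum_ne_top.2 fun x _ => ENNReal.mul_ne_top (hp x) (ha x)) (iInf_le _ a)

lemma minExcess_smul [Nonempty A] (c : ℝ≥0) (p : ι → ℝ≥0∞) :
    minExcess e (fun x => c * p x) = c * minExcess e p := by
  rcases eq_or_ne c 0 with rfl | hc
  · simp [minExcess]
  · simp only [minExcess, mul_assoc, ← Finset.mul_sum]
    exact (ENNReal.mul_iInf_of_ne (ENNReal.coe_ne_zero.2 hc) ENNReal.coe_ne_top).symm

lemma minExcess_add_le (p q : ι → ℝ≥0∞) :
    minExcess e p + minExcess e q ≤ minExcess e (fun x => p x + q x) := by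
  refine le_iInf fun a => ?_
  simp only [add_mul, Finset.sum_add_distrib]
  exact add_le_add (iInf_le _ a) (iInf_le _ a)

lemma minExcess_single [DecidableEq ι] (x : ι) : minExcess e (Pi.single x 1) = ⨅ a, e x a := by
  simp [minExcess, Pi.single_apply]

lemma exists_seq_minExcess_eq [Nonempty A] (e : ι → A → ℝ≥0∞) :
    ∃ a : ℕ → A, ∀ p : ι → ℝ≥0∞, (∀ x, p x ≠ ⊤) → minExcess e p = ⨅ k, ∑ x, p x * e x (a k) := by
  obtain ⟨u, hu⟩ := TopologicalSpace.exists_dense_seq (Set.range fun a x => e x a)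
  choose a ha using fun k => (u k).2
  refine ⟨a, fun p hp => le_antisymm (le_iInf fun k => iInf_le _ _) (le_iInf fun b => ?_)⟩
  refine le_of_forall_gt fun r hr => ?_
  have hcont : Continuous fun v : Set.range fun a x => e x a => ∑ x, p x * v.1 x :=
    continuous_finsetSum _ fun x _ => (ENNReal.continuous_const_mul (hp x)).comp
      ((continuous_apply x).comp continuous_subtype_val)
  obtain ⟨k, hk⟩ := hu.exists_mem_open (isOpen_Iio.preimage hcont) ⟨⟨_, b, rfl⟩, hr⟩
  simp only [Set.mem_preimage, Set.mem_Iio, ← ha k] at hk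
  exact (iInf_le _ k).trans_lt hk

variable {𝒮 : Type*} [MeasurableSpace 𝒮] {κ : 𝒮 → ι → ℝ≥0∞}

lemma measurable_minExcess [Nonempty A] (e : ι → A → ℝ≥0∞) (hκ : ∀ x, Measurable fun s => κ s x)
    (hfin : ∀ s x, κ s x ≠ ⊤) : Measurable fun s => minExcess e (κ s) := by
  obtain ⟨a, ha⟩ := exists_seq_minExcess_eq e
  simp only [fun s => ha (κ s) (hfin s)]
  exact Measurable.iInf fun k => Finset.measurable_sum _ fun x _ => (hκ x).mul_const _

lemma exists_measurable_minExcess_add_le [MeasurableSpace A] (he : ∃ a, ∀ x, e x a ≠ ⊤)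
    (hκ : ∀ x, Measurable fun s => κ s x) (hfin : ∀ s x, κ s x ≠ ⊤) {δ : 𝒮 → ℝ≥0∞}
    (hδ : Measurable δ) (hpos : ∀ s, δ s ≠ 0) :
    ∃ g : 𝒮 → A, Measurable g ∧ ∀ s, ∑ x, κ s x * e x (g s) ≤ minExcess e (κ s) + δ s := by
  classical
  have : Nonempty A := ⟨he.choose⟩
  obtain ⟨a, ha⟩ := exists_seq_minExcess_eq e
  have hex (s : 𝒮) : ∃ k, ∑ x, κ s x * e x (a k) ≤ minExcess e (κ s) + δ s := by
    have hlt : minExcess e (κ s) < minExcess e (κ s) + δ s :=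
      ENNReal.lt_add_right (minExcess_ne_top he (hfin s)) (hpos s)
    conv_lhs at hlt => rw [ha (κ s) (hfin s)]
    obtain ⟨k, hk⟩ := iInf_lt_iff.1 hlt
    exact ⟨k, hk.le⟩
  refine ⟨fun s => a (Nat.find (hex s)), ?_, fun s => Nat.find_spec (hex s)⟩
  refine (measurable_of_countable a).comp (measurable_find hex fun k => measurableSet_le ?_ ?_)
  · exact Finset.measurable_sum _ fun x _ => (hκ x).mul_const _
  · exact (measurable_minExcess e hκ hfin).add hδ

lemma iInf_lintegral_eq_lintegral_minExcess [MeasurableSpace A] (he : ∃ a, ∀ x, e x a ≠ ⊤)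
    (ν : Measure 𝒮) [SigmaFinite ν] (hκ : ∀ x, Measurable fun s => κ s x)
    (hfin : ∀ s x, κ s x ≠ ⊤) :
    ⨅ g : {g : 𝒮 → A // Measurable g}, ∫⁻ s, ∑ x, κ s x * e x (g.1 s) ∂ν =
      ∫⁻ s, minExcess e (κ s) ∂ν := by
  refine le_antisymm (ENNReal.le_of_forall_pos_le_add fun ε hε _ => ?_)
    (le_iInf fun g => lintegral_mono fun s => iInf_le _ _)
  obtain ⟨δ, hδpos, hδ, hδε⟩ :=
    exists_pos_lintegral_lt_of_sigmaFinite ν (ENNReal.coe_ne_zero.2 hε.ne')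
  obtain ⟨g, hg, hle⟩ := exists_measurable_minExcess_add_le he hκ hfin hδ.coe_nnreal_ennreal
    fun s => ENNReal.coe_ne_zero.2 (hδpos s).ne'
  calc ⨅ g : {g : 𝒮 → A // Measurable g}, ∫⁻ s, ∑ x, κ s x * e x (g.1 s) ∂ν
      ≤ ∫⁻ s, ∑ x, κ s x * e x (g s) ∂ν := iInf_le_of_le ⟨g, hg⟩ le_rfl
    _ ≤ ∫⁻ s, (minExcess e (κ s) + δ s) ∂ν := lintegral_mono hle
    _ = ∫⁻ s, minExcess e (κ s) ∂ν + ∫⁻ s, δ s ∂ν :=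
      lintegral_add_right _ hδ.coe_nnreal_ennreal
    _ ≤ ∫⁻ s, minExcess e (κ s) ∂ν + ε := by gcongr

end MinExcess

/-! ### Normalized losses -/

section Loss

variable {n : ℕ} {A Ω 𝒮 : Type*} [MeasurableSpace Ω] [MeasurableSpace 𝒮]

section Normalization

lemma coe_add_toENNReal_sub {r : ℝ} {u : EReal} (h : (r : EReal) ≤ u) :
    (r : EReal) + (u - r).toENNReal = u := by
  rw [EReal.coe_toENNReal ((EReal.sub_nonneg (by simp) (by simp)).2 h), add_comm,
    EReal.sub_add_cancel]

lemma exists_action_ne_top_of_risk_ne_top {ℓ : Fin n → A → EReal} {m : Fin n → ℝ}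
    {e : Fin n → A → ℝ≥0∞} (hℓ : ∀ x a, ℓ x a = (m x : EReal) + (e x a : EReal))
    {μ : Measure (Fin n)} [IsFiniteMeasure μ] (hμ : ∀ x, μ {x} ≠ 0) (hrisk : risk ℓ μ id ≠ ⊤) :
    ∃ a, ∀ x, e x a ≠ ⊤ := by
  obtain ⟨a, ha⟩ := iInf_lt_iff.1 hrisk.lt_top
  refine ⟨a, fun x hx => ha.ne ?_⟩
  have htop : ∫⁻ x, e x a ∂μ = ⊤ := by
    rw [lintegral_fintype]
    exact ENNReal.sum_eq_top.2 ⟨x, Finset.mem_univ _, by rw [hx, ENNReal.top_mul (hμ x)]⟩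
  simp only [id, hℓ]
  rw [expect_coe_add μ .of_finite (measurable_of_finite _).aemeasurable, htop]
  simp

variable [MeasurableSpace A]

/-- A loss written as a finite baseline of each letter plus a nonnegative excess. The excess of
each letter has infimum `0` and some action has finite excess at all letters. -/
structure IsNormalized (ℓ : Fin n → A → EReal) (m : Fin n → ℝ) (e : Fin n → A → ℝ≥0∞) :
    Prop where
  measurable : ∀ x, Measurable (e x)
  eq_add : ∀ x a, ℓ x a = (m x : EReal) + (e x a : EReal)
  iInf_eq : ∀ x, ⨅ a, e x a = 0
  exists_finite : ∃ a, ∀ x, e x a ≠ ⊤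

lemma risk_eq_riskGiven_const (ℓ : Fin n → A → EReal) (μ : Measure Ω) (X : Ω → Fin n) (s : 𝒮) :
    risk ℓ μ X = riskGiven ℓ μ X (fun _ => s) := by
  apply le_antisymm
  · exact le_iInf fun g => iInf_le _ (g.1 s)
  · exact le_iInf fun a => iInf_le_of_le ⟨fun _ => a, measurable_const⟩ le_rfl

variable {ℓ : Fin n → A → EReal}

lemma WellDefined.risk_ne (hwd : WellDefined ℓ) {Ω : Type} [MeasurableSpace Ω] (μ : Measure Ω)
    [IsProbabilityMeasure μ] {X : Ω → Fin n} (hX : Measurable X) :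
    risk ℓ μ X ≠ ⊤ ∧ risk ℓ μ X ≠ ⊥ := by
  have h := hwd Ω μ 1 X (fun _ => 0) hX measurable_const
  rwa [← risk_eq_riskGiven_const, and_self, and_self] at h

lemma WellDefined.iInf_loss_ne (hwd : WellDefined ℓ) (x : Fin n) :
    (⨅ a, ℓ x a) ≠ ⊤ ∧ (⨅ a, ℓ x a) ≠ ⊥ := by
  simpa only [risk, expect_dirac] using
    hwd.risk_ne (Measure.dirac ()) (X := fun _ => x) measurable_const

lemma WellDefined.exists_isNormalized [NeZero n] (hwd : WellDefined ℓ)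
    (hmeas : ∀ x, Measurable (ℓ x)) : ∃ m e, IsNormalized ℓ m e := by
  set m : Fin n → ℝ := fun x => (⨅ a, ℓ x a).toReal
  set e : Fin n → A → ℝ≥0∞ := fun x a => (ℓ x a - m x).toENNReal
  have hm (x : Fin n) : (m x : EReal) = ⨅ a, ℓ x a :=
    EReal.coe_toReal (hwd.iInf_loss_ne x).1 (hwd.iInf_loss_ne x).2
  have hℓ (x : Fin n) (a : A) : ℓ x a = (m x : EReal) + e x a :=
    (coe_add_toENNReal_sub ((hm x).trans_le (iInf_le _ a))).symm
  refine ⟨m, e, fun x => ((hmeas x).add_const (-(m x : EReal))).ereal_toENNReal, hℓ,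
    fun x => ?_, ?_⟩
  · have h : (m x : EReal) + (⨅ a, e x a : ℝ≥0∞) = m x + (0 : ℝ≥0∞) := by
      rw [coe_add_iInf, ← iInf_congr (hℓ x), ← hm, EReal.coe_ennreal_zero, add_zero]
    exact EReal.coe_ennreal_injective ((EReal.addLECancellable_coe (m x)).inj.1 h)
  · refine exists_action_ne_top_of_risk_ne_top hℓ
      (μ := ProbabilityTheory.uniformOn (Set.univ : Set (Fin n))) (fun x => ?_)
      (hwd.risk_ne _ measurable_id).1
    simp [ProbabilityTheory.uniformOn_univ]

end Normalization

namespace IsNormalized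

variable [MeasurableSpace A] {ℓ : Fin n → A → EReal} {m : Fin n → ℝ} {e : Fin n → A → ℝ≥0∞}
  {X : Ω → Fin n}

lemma measurable_comp (h : IsNormalized ℓ m e) (hX : Measurable X) {g : Ω → A}
    (hg : Measurable g) : Measurable fun ω => e (X ω) (g ω) :=
  (measurable_from_prod_countable_left (f := fun q : A × Fin n => e q.2 q.1) h.measurable).comp
    (hg.prodMk hX)

lemma riskGiven_eq_integral_add_iInf (h : IsNormalized ℓ m e) (μ : Measure Ω) [IsFiniteMeasure μ]
    (hX : Measurable X) {S : Ω → 𝒮} (hS : Measurable S) :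
    riskGiven ℓ μ X S = ((∫ ω, m (X ω) ∂μ : ℝ) : EReal) +
      (⨅ g : {g : 𝒮 → A // Measurable g}, ∫⁻ ω, e (X ω) (g.1 (S ω)) ∂μ : ℝ≥0∞) := by
  rw [coe_add_iInf]
  refine iInf_congr fun g => ?_
  simp only [h.eq_add]
  exact expect_coe_add μ ((Integrable.of_finite (f := m)).comp_measurable hX)
    (h.measurable_comp hX (g.2.comp hS)).aemeasurable

lemma riskGiven_eq_of_disintegration (h : IsNormalized ℓ m e) (μ : Measure Ω) [IsFiniteMeasure μ]
    (hX : Measurable X) {S : Ω → 𝒮} (hS : Measurable S) (ν : Measure 𝒮) [SigmaFinite ν]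
    {κ : 𝒮 → Fin n → ℝ≥0∞} (hκ : ∀ x, Measurable fun s => κ s x) (hfin : ∀ s x, κ s x ≠ ⊤)
    (hdis : ∀ f : Fin n → 𝒮 → ℝ≥0∞, (∀ x, Measurable (f x)) →
      ∫⁻ ω, f (X ω) (S ω) ∂μ = ∫⁻ s, ∑ x, κ s x * f x s ∂ν) :
    riskGiven ℓ μ X S = ((∫ ω, m (X ω) ∂μ : ℝ) : EReal) +
      (∫⁻ s, minExcess e (κ s) ∂ν : ℝ≥0∞) := by
  rw [h.riskGiven_eq_integral_add_iInf μ hX hS,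
    ← iInf_lintegral_eq_lintegral_minExcess h.exists_finite ν hκ hfin]
  simp only [fun g : {g : 𝒮 → A // Measurable g} =>
    hdis (fun x s => e x (g.1 s)) fun x => (h.measurable x).comp g.2]

end IsNormalized

lemma lintegral_comp_eq_sum (μ : Measure Ω) {𝒳 𝒴 : Type*} [Fintype 𝒳] [MeasurableSpace 𝒳]
    [MeasurableSingletonClass 𝒳] [Fintype 𝒴] [MeasurableSpace 𝒴] [MeasurableSingletonClass 𝒴]
    {X : Ω → 𝒳} (hX : Measurable X) {Y : Ω → 𝒴} (hY : Measurable Y) (f : 𝒳 → 𝒴 → ℝ≥0∞) :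
    ∫⁻ ω, f (X ω) (Y ω) ∂μ = ∑ y, ∑ x, μ {ω | X ω = x ∧ Y ω = y} * f x y := by
  rw [← lintegral_map (f := fun q : 𝒳 × 𝒴 => f q.1 q.2) (measurable_of_finite _)
    (hX.prodMk hY), lintegral_fintype, Fintype.sum_prod_type_right]
  refine Fintype.sum_congr _ _ fun y => Fintype.sum_congr _ _ fun x => ?_
  rw [Measure.map_apply (hX.prodMk hY) (measurableSet_singleton _), mul_comm]
  simp only [Set.preimage, Set.mem_singleton_iff, Prod.mk.injEq]

lemma sum_measure_eq_and {𝒰 : Type*} [Fintype 𝒰] [MeasurableSpace 𝒰] [MeasurableSingletonClass 𝒰]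
    (μ : Measure Ω) {U : Ω → 𝒰} (hU : Measurable U) (P : Ω → Prop) :
    ∑ u, μ {ω | U ω = u ∧ P ω} = μ {ω | P ω} := by
  have h := sum_measure_preimage_singleton (μ := μ.restrict {ω | P ω}) Finset.univ (f := U)
    fun u _ => hU (measurableSet_singleton u)
  rw [Finset.coe_univ, Set.preimage_univ, Measure.restrict_apply_univ] at h
  rw [← h]
  exact Fintype.sum_congr _ _ fun u =>
    (Measure.restrict_apply (hU (measurableSet_singleton u))).symm

/-- The minimal excess of a measure on the alphabet, as a real-valued functional. -/
noncomputable def excessValue (e : Fin n → A → ℝ≥0∞) (p : Fin n → ℝ≥0) : ℝ :=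
  (minExcess e fun x => p x).toReal

namespace IsNormalized

variable [MeasurableSpace A] {ℓ : Fin n → A → EReal} {m : Fin n → ℝ} {e : Fin n → A → ℝ≥0∞}
  {X : Ω → Fin n}

lemma minExcess_coe_ne_top (h : IsNormalized ℓ m e) (p : Fin n → ℝ≥0) :
    minExcess e (fun x => p x) ≠ ⊤ :=
  minExcess_ne_top h.exists_finite fun _ => ENNReal.coe_ne_top

lemma excessValue_smul (h : IsNormalized ℓ m e) (c : ℝ≥0) (p : Fin n → ℝ≥0) :
    excessValue e (c • p) = c * excessValue e p := by
  have : Nonempty A := ⟨h.exists_finite.choose⟩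
  simp only [excessValue, Pi.smul_apply, smul_eq_mul, ENNReal.coe_mul, minExcess_smul,
    ENNReal.toReal_mul, ENNReal.coe_toReal]

lemma excessValue_add_le (h : IsNormalized ℓ m e) (p q : Fin n → ℝ≥0) :
    excessValue e p + excessValue e q ≤ excessValue e (p + q) := by
  rw [excessValue, excessValue, excessValue,
    ← ENNReal.toReal_add (h.minExcess_coe_ne_top p) (h.minExcess_coe_ne_top q)]
  refine ENNReal.toReal_mono (h.minExcess_coe_ne_top (p + q)) ?_
  simpa only [Pi.add_apply, ENNReal.coe_add] using minExcess_add_le _ _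

lemma excessValue_single_one (h : IsNormalized ℓ m e) (x : Fin n) :
    excessValue e (Pi.single x 1) = 0 := by
  have hcoe : (fun y => ((Pi.single x 1 : Fin n → ℝ≥0) y : ℝ≥0∞)) = Pi.single x 1 := by
    ext y
    exact_mod_cast Pi.apply_single (fun _ => ((↑) : ℝ≥0 → ℝ≥0∞)) (fun _ => rfl) x 1 y
  rw [excessValue, hcoe, minExcess_single, h.iInf_eq, ENNReal.toReal_zero]

lemma riskGiven_eq_of_law (h : IsNormalized ℓ m e) (μ : Measure Ω) [IsFiniteMeasure μ]
    (hX : Measurable X) {𝒴 : Type*} [Fintype 𝒴] [MeasurableSpace 𝒴] [MeasurableSingletonClass 𝒴]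
    {Y : Ω → 𝒴} (hY : Measurable Y) {p : 𝒴 → Fin n → ℝ≥0}
    (hp : ∀ x y, μ {ω | X ω = x ∧ Y ω = y} = p y x) :
    riskGiven ℓ μ X Y = ((∫ ω, m (X ω) ∂μ : ℝ) : EReal) +
      (∑ y, minExcess e (fun x => p y x) : ℝ≥0∞) := by
  rw [h.riskGiven_eq_of_disintegration μ hX hY Measure.count
    (κ := fun y x => p y x) (fun x => measurable_of_finite _) (fun _ _ => ENNReal.coe_ne_top),
    lintegral_count, tsum_fintype]
  intro f _
  rw [lintegral_comp_eq_sum μ hX hY, lintegral_count, tsum_fintype]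
  simp only [hp]

lemma benefit_eq_of_law (h : IsNormalized ℓ m e) (μ : Measure Ω) [IsFiniteMeasure μ]
    (hX : Measurable X) {k : ℕ} {Y : Ω → Fin k} (hY : Measurable Y) {p : Fin k → Fin n → ℝ≥0}
    (hp : ∀ x y, μ {ω | X ω = x ∧ Y ω = y} = p y x) :
    benefit ℓ μ X Y =
      ((excessValue e (∑ y, p y) - ∑ y, excessValue e (p y) : ℝ) : EReal) := by
  have hmarginal (x : Fin n) : μ {ω | X ω = x ∧ () = ()} = (∑ y, p y) x := by
    simp only [and_true, Finset.sum_apply, ENNReal.ofNNReal_finsetSum, ← hp]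
    rw [← sum_measure_eq_and μ hY]
    simp only [and_comm]
  rw [benefit, risk_eq_riskGiven_const ℓ μ X (),
    h.riskGiven_eq_of_law μ hX measurable_const fun x _ => hmarginal x,
    h.riskGiven_eq_of_law μ hX hY hp, Fintype.sum_unique,
    coe_add_coe_sub_coe_add_coe _ (h.minExcess_coe_ne_top _)
      (ENNReal.sum_ne_top.2 fun y _ => h.minExcess_coe_ne_top _),
    ENNReal.toReal_sum fun y _ => h.minExcess_coe_ne_top _]
  rfl

end IsNormalized

end Loss

/-! ### Data processing -/

section DataProcessing

/-- `U` is the output of the channel `k` with input `V`, given the pair `(V, Z)` whose joint weights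
are `a`. -/
structure IsChannelOutput {Ω 𝒰 𝒱 𝒵 : Type*} [MeasurableSpace Ω] [Fintype 𝒰] (μ : Measure Ω)
    (U : Ω → 𝒰) (V : Ω → 𝒱) (Z : Ω → 𝒵) (a : 𝒵 → 𝒱 → ℝ≥0∞) (k : 𝒱 → 𝒰 → ℝ≥0∞) : Prop where
  sum_eq_one : ∀ v, ∑ u, k v u = 1
  law : ∀ u v z, μ {ω | U ω = u ∧ V ω = v ∧ Z ω = z} = a z v * k v u

namespace IsChannelOutput

variable {Ω 𝒰 𝒱 𝒵 : Type*} [MeasurableSpace Ω] [Fintype 𝒰] [MeasurableSpace 𝒰]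
  [MeasurableSingletonClass 𝒰] {μ : Measure Ω} {U : Ω → 𝒰} {V : Ω → 𝒱} {Z : Ω → 𝒵}
  {a : 𝒵 → 𝒱 → ℝ≥0∞} {k : 𝒱 → 𝒰 → ℝ≥0∞}

lemma measure_eq_and_eq (h : IsChannelOutput μ U V Z a k) (hU : Measurable U) (v : 𝒱) (z : 𝒵) :
    μ {ω | V ω = v ∧ Z ω = z} = a z v := by
  rw [← sum_measure_eq_and μ hU]
  simp only [h.law, ← Finset.mul_sum, h.sum_eq_one, mul_one]

lemma markovChain [Finite 𝒵] [MeasurableSpace 𝒵] [MeasurableSingletonClass 𝒵]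
    (h : IsChannelOutput μ U V Z a k) (hU : Measurable U) (hZ : Measurable Z) :
    MarkovChain μ U V Z := by
  intro u v z
  have := Fintype.ofFinite 𝒵
  have hV : μ {ω | V ω = v} = ∑ z, a z v := by
    rw [← sum_measure_eq_and μ hZ]
    simp only [and_comm, h.measure_eq_and_eq hU]
  have hUV : μ {ω | U ω = u ∧ V ω = v} = (∑ z, a z v) * k v u := by
    rw [← sum_measure_eq_and μ hZ, Finset.sum_mul]
    refine Fintype.sum_congr _ _ fun z => ?_
    rw [← h.law]
    simp only [and_comm (a := Z _ = z), and_assoc]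
  rw [h.law, hV, hUV, h.measure_eq_and_eq hU]
  ring

end IsChannelOutput

variable {n : ℕ} {A : Type*} [MeasurableSpace A] {ℓ : Fin n → A → EReal}

lemma DataProcessingAxiom.benefit_eq (hdpa : DataProcessingAxiom ℓ) {Ω : Type} [MeasurableSpace Ω]
    (μ : Measure Ω) [IsProbabilityMeasure μ] {k : ℕ} {X T : Ω → Fin n} {Y : Ω → Fin k}
    (hX : Measurable X) (hT : Measurable T) (hY : Measurable Y) (h : Sufficient μ T X Y) :
    benefit ℓ μ T Y = benefit ℓ μ X Y :=
  le_antisymm (hdpa Ω μ k X T Y hX hT hY h) (hdpa Ω μ k T X Y hT hX hY h.symm)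

lemma exists_isProbabilityMeasure_singleton_eq {α : Type*} [Fintype α] [MeasurableSpace α]
    [MeasurableSingletonClass α] (w : α → ℝ≥0) (hw : ∑ x, w x = 1) :
    ∃ μ : Measure α, IsProbabilityMeasure μ ∧ ∀ x, μ {x} = w x := by
  have hw' : ∑ x, (w x : ℝ≥0∞) = 1 := by exact_mod_cast hw
  exact ⟨(PMF.ofFintype (fun x => (w x : ℝ≥0∞)) hw').toMeasure, inferInstance, fun x =>
    PMF.toMeasure_apply_singleton _ x (measurableSet_singleton x)⟩

section Reversal

variable {ι 𝒴 : Type*} [Fintype ι] [DecidableEq ι] {K R : Matrix ι ι ℝ≥0} {p p' : 𝒴 → ι → ℝ≥0}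

lemma exists_isChannelOutput [MeasurableSpace ι] [MeasurableSingletonClass ι] [Fintype 𝒴]
    [MeasurableSpace 𝒴] [MeasurableSingletonClass 𝒴] (hK : K ∈ Matrix.rowStochastic ℝ≥0 ι)
    (hsum : ∑ y, ∑ x, p y x = 1) :
    ∃ μ : Measure (ι × ι × 𝒴), IsProbabilityMeasure μ ∧
      IsChannelOutput μ (fun ω => ω.2.1) (fun ω => ω.1) (fun ω => ω.2.2) (fun y x => p y x)
        fun x t => K x t := by
  have hmass : ∑ ω : ι × ι × 𝒴, p ω.2.2 ω.1 * K ω.1 ω.2.1 = 1 := by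
    simp only [Fintype.sum_prod_type, ← hsum]
    rw [Finset.sum_comm (s := (Finset.univ : Finset 𝒴))]
    refine Fintype.sum_congr _ _ fun x => ?_
    rw [Finset.sum_comm]
    simp only [← Finset.mul_sum, Matrix.sum_row_of_mem_rowStochastic hK, mul_one]
  obtain ⟨μ, hprob, hμ⟩ := exists_isProbabilityMeasure_singleton_eq _ hmass
  refine ⟨μ, hprob, fun x => ?_, fun t x y => ?_⟩
  · exact_mod_cast Matrix.sum_row_of_mem_rowStochastic hK x
  · rw [← ENNReal.coe_mul, ← hμ (x, t, y)]
    congr 1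
    ext ω
    simp only [Set.mem_ofPred_eq, Set.mem_singleton_iff, Prod.ext_iff]
    tauto

lemma IsChannelOutput.reverse {Ω : Type*} [MeasurableSpace Ω] {μ : Measure Ω} {T X : Ω → ι}
    {Y : Ω → 𝒴} (h : IsChannelOutput μ T X Y (fun y x => p y x) fun x t => K x t)
    (hR : R ∈ Matrix.rowStochastic ℝ≥0 ι) (hp : ∀ y, IsReversal K R (p y) (p' y)) :
    IsChannelOutput μ X T Y (fun y t => p' y t) fun t x => R t x := by
  refine ⟨fun t => ?_, fun x t y => ?_⟩
  · exact_mod_cast Matrix.sum_row_of_mem_rowStochastic hR t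
  · rw [← ENNReal.coe_mul, ← hp y x t, ENNReal.coe_mul, ← h.law]
    simp only [and_left_comm]

end Reversal

namespace IsNormalized

variable {m : Fin n → ℝ} {e : Fin n → A → ℝ≥0∞}

lemma defect_eq_of_sum_eq_one (h : IsNormalized ℓ m e) (hdpa : DataProcessingAxiom ℓ)
    {K R : Matrix (Fin n) (Fin n) ℝ≥0} (hK : K ∈ Matrix.rowStochastic ℝ≥0 (Fin n))
    (hR : R ∈ Matrix.rowStochastic ℝ≥0 (Fin n)) {k : ℕ} {p p' : Fin k → Fin n → ℝ≥0}
    (hp : ∀ y, IsReversal K R (p y) (p' y)) (hsum : ∑ y, ∑ x, p y x = 1) :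
    excessValue e (∑ y, p' y) - ∑ y, excessValue e (p' y) =
      excessValue e (∑ y, p y) - ∑ y, excessValue e (p y) := by
  obtain ⟨μ, _, hTXY⟩ := exists_isChannelOutput hK hsum
  have hXTY := hTXY.reverse hR hp
  have hX : Measurable fun ω : Fin n × Fin n × Fin k => ω.1 := measurable_fst
  have hT : Measurable fun ω : Fin n × Fin n × Fin k => ω.2.1 := measurable_snd.fst
  have hY : Measurable fun ω : Fin n × Fin n × Fin k => ω.2.2 := measurable_snd.snd
  have hbenefit := hdpa.benefit_eq μ hX hT hY ⟨hTXY.markovChain hT hY, hXTY.markovChain hX hY⟩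
  rwa [h.benefit_eq_of_law μ hT hY (hXTY.measure_eq_and_eq hX),
    h.benefit_eq_of_law μ hX hY (hTXY.measure_eq_and_eq hT), EReal.coe_eq_coe_iff] at hbenefit

lemma defect_eq (h : IsNormalized ℓ m e) (hdpa : DataProcessingAxiom ℓ)
    {K R : Matrix (Fin n) (Fin n) ℝ≥0} (hK : K ∈ Matrix.rowStochastic ℝ≥0 (Fin n))
    (hR : R ∈ Matrix.rowStochastic ℝ≥0 (Fin n)) {k : ℕ} {p p' : Fin k → Fin n → ℝ≥0}
    (hp : ∀ y, IsReversal K R (p y) (p' y)) :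
    excessValue e (∑ y, p' y) - ∑ y, excessValue e (p' y) =
      excessValue e (∑ y, p y) - ∑ y, excessValue e (p y) := by
  rcases eq_or_ne (∑ y, ∑ x, p y x) 0 with hzero | hpos
  · have hp0 : p = 0 := by
      ext y x
      simp_all
    have hp'0 : p' = 0 := by
      ext y t
      simp [(hp y).apply_eq_sum hR t, hp0]
    rw [hp0, hp'0]
  · set c := ∑ y, ∑ x, p y x
    have hscaled := h.defect_eq_of_sum_eq_one hdpa hK hR (fun y => (hp y).smul c⁻¹) (by
      simp only [Pi.smul_apply, smul_eq_mul, ← Finset.mul_sum]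
      exact inv_mul_cancel₀ hpos)
    simp only [← Finset.smul_sum, h.excessValue_smul, ← Finset.mul_sum, ← mul_sub] at hscaled
    exact mul_left_cancel₀ (NNReal.coe_ne_zero.2 (inv_ne_zero hpos)) hscaled

lemma isSufficiencyInvariant (h : IsNormalized ℓ m e) (hdpa : DataProcessingAxiom ℓ) :
    IsSufficiencyInvariant (excessValue e) where
  map_smul := h.excessValue_smul
  add_le := h.excessValue_add_le
  map_single_one := h.excessValue_single_one
  defect_eq K R hK hR p q p' q' hp hq := by
    simpa [← sub_sub] using h.defect_eq hdpa hK hR (p := ![p, q]) (p' := ![p', q'])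
      (by simp [Fin.forall_fin_two, hp, hq])

end IsNormalized

end DataProcessing

/-! ### Entropy -/

section Entropy

variable {ι : Type*} [Fintype ι] [MeasurableSpace ι]

/-- The Shannon entropy, in nats, of a measure on a finite alphabet. -/
noncomputable def measureEntropy (ν : Measure ι) : ℝ :=
  ∑ x, Real.negMulLog (ν.real {x})

lemma measureEntropy_nonneg (ν : Measure ι) [IsZeroOrProbabilityMeasure ν] :
    0 ≤ measureEntropy ν :=
  Finset.sum_nonneg fun _ _ => Real.negMulLog_nonneg measureReal_nonneg measureReal_le_one

lemma measureEntropy_le_card (ν : Measure ι) : measureEntropy ν ≤ Fintype.card ι := by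
  refine (Finset.sum_le_card_nsmul _ _ 1 fun x _ => ?_).trans_eq (by simp)
  exact (Real.negMulLog_le_one_sub_self measureReal_nonneg).trans
    (sub_le_self _ measureReal_nonneg)

variable [MeasurableSingletonClass ι]

lemma coneEntropy_toNNReal_singleton (ν : Measure ι) [IsProbabilityMeasure ν] :
    coneEntropy (fun x => (ν {x}).toNNReal) = measureEntropy ν := by
  have hmass : ∑ x, ν.real {x} = 1 := by
    rw [sum_measureReal_singleton, Finset.coe_univ, probReal_univ]
  change measureEntropy ν - Real.negMulLog (∑ x, ν.real {x}) = _
  rw [hmass, Real.negMulLog_one, sub_zero]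

lemma measurable_measureEntropy {𝒮 : Type*} [MeasurableSpace 𝒮]
    (κ : ProbabilityTheory.Kernel 𝒮 ι) : Measurable fun s => measureEntropy (κ s) :=
  Finset.measurable_sum _ fun x _ => Real.continuous_negMulLog.measurable.comp
    (κ.measurable_coe (measurableSet_singleton x)).ennreal_toReal

end Entropy

section Disintegration

variable {Ω 𝒮 : Type*} [MeasurableSpace Ω] [MeasurableSpace 𝒮]

lemma lintegral_comp_eq_lintegral_sum_condDistrib {ι : Type*} [Fintype ι] [Nonempty ι]
    [MeasurableSpace ι] [MeasurableSingletonClass ι] (μ : Measure Ω) [IsFiniteMeasure μ]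
    {X : Ω → ι} (hX : Measurable X) {S : Ω → 𝒮} (hS : Measurable S) {f : ι → 𝒮 → ℝ≥0∞}
    (hf : ∀ x, Measurable (f x)) :
    ∫⁻ ω, f (X ω) (S ω) ∂μ =
      ∫⁻ s, ∑ x, ProbabilityTheory.condDistrib X S μ s {x} * f x s ∂(μ.map S) := by
  have hf' : Measurable fun q : 𝒮 × ι => f q.2 q.1 :=
    measurable_from_prod_countable_left hf
  rw [← lintegral_map (f := fun q : 𝒮 × ι => f q.2 q.1) hf' (hS.prodMk hX),
    ← ProbabilityTheory.compProd_map_condDistrib hX.aemeasurable, Measure.lintegral_compProd hf']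
  simp only [lintegral_fintype, mul_comm]

variable {n : ℕ} [NeZero n] (μ : Measure Ω) [IsFiniteMeasure μ] {X : Ω → Fin n}
  (hX : Measurable X) {S : Ω → 𝒮} (hS : Measurable S)
include hX hS

lemma condEntropy_eq_integral_measureEntropy :
    condEntropy μ X S =
      ∫ ω, measureEntropy (ProbabilityTheory.condDistrib X S μ (S ω)) ∂μ := by
  refine integral_congr_ae ?_
  filter_upwards [ae_all_iff.2 fun x =>
    ProbabilityTheory.condDistrib_ae_eq_condExp hS hX (measurableSet_singleton x)] with ω hω
  exact Fintype.sum_congr _ _ fun x => by rw [hω x]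

lemma condEntropy_nonneg : 0 ≤ condEntropy μ X S := by
  rw [condEntropy_eq_integral_measureEntropy μ hX hS]
  exact integral_nonneg fun ω => measureEntropy_nonneg _

lemma lintegral_ofReal_mul_measureEntropy {c : ℝ} (hc : 0 ≤ c) :
    ∫⁻ s, ENNReal.ofReal (c * measureEntropy (ProbabilityTheory.condDistrib X S μ s)) ∂(μ.map S) =
      ENNReal.ofReal (c * condEntropy μ X S) := by
  set κ := ProbabilityTheory.condDistrib X S μ
  have hmeas : Measurable fun s => measureEntropy (κ s) := measurable_measureEntropy κ
  have hint : Integrable (fun ω => measureEntropy (κ (S ω))) μ := by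
    refine .of_bound (hmeas.comp hS).aestronglyMeasurable (Fintype.card (Fin n)) (.of_forall ?_)
    intro ω
    rw [Real.norm_of_nonneg (measureEntropy_nonneg _)]
    exact measureEntropy_le_card _
  rw [lintegral_map (hmeas.const_mul c).ennreal_ofReal hS,
    ← ofReal_integral_eq_lintegral_ofReal (hint.const_mul c)
      (.of_forall fun ω => mul_nonneg hc (measureEntropy_nonneg _)),
    integral_const_mul, condEntropy_eq_integral_measureEntropy μ hX hS]

end Disintegration

namespace IsNormalized

variable {n : ℕ} {A : Type*} [MeasurableSpace A] {ℓ : Fin n → A → EReal} {m : Fin n → ℝ}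
  {e : Fin n → A → ℝ≥0∞} {c : ℝ}

lemma minExcess_measure (h : IsNormalized ℓ m e)
    (hval : ∀ p, excessValue e p = c * coneEntropy p) (ν : Measure (Fin n))
    [IsProbabilityMeasure ν] :
    minExcess e (fun x => ν {x}) = ENNReal.ofReal (c * measureEntropy ν) := by
  have hν : (fun x => ((ν {x}).toNNReal : ℝ≥0∞)) = fun x => ν {x} :=
    funext fun x => ENNReal.coe_toNNReal (measure_ne_top ν {x})
  rw [← coneEntropy_toNNReal_singleton, ← hval, excessValue,
    ENNReal.ofReal_toReal (h.minExcess_coe_ne_top _), hν]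

theorem riskGiven_eq_condEntropy [NeZero n] (h : IsNormalized ℓ m e) (hc : 0 ≤ c)
    (hval : ∀ p, excessValue e p = c * coneEntropy p) {Ω 𝒮 : Type*} [MeasurableSpace Ω]
    [MeasurableSpace 𝒮] (μ : Measure Ω) [IsFiniteMeasure μ] {X : Ω → Fin n}
    (hX : Measurable X) {S : Ω → 𝒮} (hS : Measurable S) :
    riskGiven ℓ μ X S = ((∫ ω, m (X ω) ∂μ + c * condEntropy μ X S : ℝ) : EReal) := by
  set κ := ProbabilityTheory.condDistrib X S μ
  rw [h.riskGiven_eq_of_disintegration μ hX hS (μ.map S) (κ := fun s x => κ s {x})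
    (fun x => κ.measurable_coe (measurableSet_singleton x)) (fun s x => measure_ne_top (κ s) {x})
    fun f hf => lintegral_comp_eq_lintegral_sum_condDistrib μ hX hS hf]
  simp only [h.minExcess_measure hval]
  rw [lintegral_ofReal_mul_measureEntropy μ hX hS hc, EReal.coe_ennreal_ofReal,
    max_eq_left (mul_nonneg hc (condEntropy_nonneg μ hX hS)), EReal.coe_add]

end IsNormalized

end SideInfo

theorem corollary1 {n : ℕ} (hn : 3 ≤ n) {A : Type*} [MeasurableSpace A]
    (ℓ : Fin n → A → EReal) (hmeas : ∀ x, Measurable (ℓ x))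
    (hwd : SideInfo.WellDefined ℓ) (hdpa : SideInfo.DataProcessingAxiom ℓ) :
    ∃ c : ℝ, 0 ≤ c ∧
      ∀ (Ω : Type*) (𝒴 : Type*) (𝒲 : Type*) [MeasurableSpace Ω] [MeasurableSpace 𝒴]
        [MeasurableSpace 𝒲] (μ : Measure Ω) [IsProbabilityMeasure μ]
        (X : Ω → Fin n) (Y : Ω → 𝒴) (W : Ω → 𝒲),
        Measurable X → Measurable Y → Measurable W →
        SideInfo.benefitGiven ℓ μ X Y W = ((c * SideInfo.condMutualInfo μ X Y W : ℝ) : EReal) := by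
  have : NeZero n := ⟨by omega⟩
  obtain ⟨m, e, he⟩ := hwd.exists_isNormalized hmeas
  obtain ⟨c, hc, hval⟩ := (he.isSufficiencyInvariant hdpa).exists_eq_coneEntropy (by simpa using hn)
  refine ⟨c, hc, fun Ω 𝒴 𝒲 _ _ _ μ _ X Y W hX hY hW => ?_⟩
  rw [SideInfo.benefitGiven, he.riskGiven_eq_condEntropy hc hval μ hX hW,
    he.riskGiven_eq_condEntropy hc hval μ hX (hY.prodMk hW), ← EReal.coe_sub,
    SideInfo.condMutualInfo]
  congr 1
  ring
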